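/- **Theorem 1.1.** For a family $f=(f_n(k))$ $(n\ge 1,\ 1\le k\le 2n-1)$ of rational numbers, consider the finite difference equation system $$\Delta^2 f_n(k)+4f_{n-1}(k)=0\qquad(n\ge 2,\ 1\le k\le 2n-3),$$ where $\Delta f_n(k)=f_n(k+1)-f_n(k)$, so that $\Delta^2 f_n(k)=f_n(k+2)-2f_n(k+1)+f_n(k)$, together with one of the following sets of initial values, in which $\sum_k f_{n-1}(k)$ is the sum over $1\le k\le 2n-3$: - [tan1] $f_1(1)=1$; $f_n(1)=0$ and $f_n(2)=2\sum_k f_{n-1}(k)$ for $n\ge 2$; - [sec1] $f_1(1)=1$; $f_n(1)=\sum_k f_{n-1}(k)$ and $f_n(2)=3\sum_k f_{n-1}(k)$ for $n\ge 2$. The system has a unique solution $(g_n(k))$ with the initial values [tan1], and a unique solution $(h_n(k))$ with the initial values [sec1]. Their row sums are $$\sum_{k=1}^{2n-1}g_n(k)=T_{2n-1}\quad(n\ge 1),\qquad \sum_{k=1}^{2n-1}h_n(k)=E_{2n}\quad(n\ge 1),$$ where the tangent numbers $T_{2n+1}$ and the secant numbers $E_{2n}$ are given by the Taylor expansions at $0$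 $$\tan u=\sum_{n\ge 0}T_{2n+1}\frac{u^{2n+1}}{(2n+1)!},\qquad \sec u=\frac1{\cos u}=\sum_{n\ge 0}E_{2n}\frac{u^{2n}}{(2n)!}.$$ -/

import Mathlib

/-!
A triangular array `(f_n(k))`, `n ≥ 1`, `1 ≤ k ≤ 2n - 1`, of rational numbers is represented by a
function `f : ℕ → ℕ → ℚ`, of which only the values `f n k` inside the triangle are ever used.
-/

/-- The sum `∑_k f_n(k)` of the `n`-th row, over `1 ≤ k ≤ 2n - 1`. -/
def rowSum (f : ℕ → ℕ → ℚ) (n : ℕ) : ℚ :=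
  ∑ k ∈ Finset.Icc 1 (2 * n - 1), f n k

/-- The finite difference equation system
`Δ² f_n(k) + 4 f_{n-1}(k) = 0` for `n ≥ 2` and `1 ≤ k ≤ 2n - 3`,
where `Δ f_n(k) = f_n(k+1) - f_n(k)` acts on the variable `k`. -/
def SolvesSystem (f : ℕ → ℕ → ℚ) : Prop :=
  ∀ n k : ℕ, 2 ≤ n → 1 ≤ k → k ≤ 2 * n - 3 →
    (fwdDiff 1)^[2] (f n) k + 4 * f (n - 1) k = 0

/-- The initial values [tan1]. -/
def Tan1 (f : ℕ → ℕ → ℚ) : Prop :=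
  f 1 1 = 1 ∧ ∀ n : ℕ, 2 ≤ n → f n 1 = 0 ∧ f n 2 = 2 * rowSum f (n - 1)

/-- The initial values [sec1]. -/
def Sec1 (f : ℕ → ℕ → ℚ) : Prop :=
  f 1 1 = 1 ∧ ∀ n : ℕ, 2 ≤ n → f n 1 = rowSum f (n - 1) ∧ f n 2 = 3 * rowSum f (n - 1)

/-- Two arrays have the same entries inside the triangle. -/
def SameTriangle (f f' : ℕ → ℕ → ℚ) : Prop :=
  ∀ n k : ℕ, 1 ≤ n → 1 ≤ k → k ≤ 2 * n - 1 → f n k = f' n k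

/-- `T_m`, the coefficient of `u ^ m / m!` in the Taylor expansion of `tan u` at `0`;
the tangent numbers are those with `m` odd. -/
noncomputable def tangentNumber (m : ℕ) : ℝ :=
  iteratedDeriv m Real.tan 0

/-- `E_m`, the coefficient of `u ^ m / m!` in the Taylor expansion of `sec u = 1 / cos u` at `0`;
the secant numbers are those with `m` even. -/
noncomputable def secantNumber (m : ℕ) : ℝ :=
  iteratedDeriv m (fun u : ℝ => 1 / Real.cos u) 0

/-!
Newton's formula expresses the sum of row `n` through the differences `Δʲ f_n(1)`, and the system
turns `Δʲ⁺² f_n(1)` into `-4 Δʲ f_{n-1}(1)`. Let `R(u) = ∑ r_n u^(2n-1)/(2n-1)!`, where `r_n` is the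
sum of row `n`, and let `A(u) = ∑ f_{n+1}(1) u^(2n)/(2n)!`. Then Newton's formula reads
`R = A sin u cos u + B (sin u)² / 2`, where `B` is made of the differences
`f_{n+1}(2) - f_{n+1}(1)`. In both problems the initial values say `B = 2R`, whence
`R cos u = A sin u`. Under [tan1], `A = 1`, so `R = tan u`. Under [sec1], `A' = R`, so
`(A cos u)' = 0` and `A = sec u`.
-/

open Finset PowerSeries
open scoped ContDiff Nat Topology

section ForwardDifferences

variable {M G : Type*} [AddCommMonoid M] [AddCommGroup G]

theorem fwdDiff_iter_congr {f g : M → G} {h y : M} {n : ℕ}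
    (hfg : ∀ i ≤ n, f (y + i • h) = g (y + i • h)) : (fwdDiff h)^[n] f y = (fwdDiff h)^[n] g y := by
  rw [fwdDiff_iter_eq_sum_shift, fwdDiff_iter_eq_sum_shift]
  exact sum_congr rfl fun i hi => by rw [hfg i (mem_range_succ_iff.1 hi)]

theorem fwdDiff_iter_comp_nsmul (f : M → G) (h y : M) (n : ℕ) :
    (fwdDiff 1)^[n] (fun k : ℕ => f (y + k • h)) 0 = (fwdDiff h)^[n] f y := by
  simp [fwdDiff_iter_eq_sum_shift]

/-- Newton's formula applied to the partial sums of `f`. -/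
theorem sum_range_shift_eq_sum_fwdDiff_iter (f : M → G) (h y : M) (n : ℕ) :
    ∑ k ∈ range n, f (y + k • h) = ∑ j ∈ range n, n.choose (j + 1) • (fwdDiff h)^[j] f y := by
  have hΔ : fwdDiff 1 (fun n : ℕ => ∑ k ∈ range n, f (y + k • h)) = fun k => f (y + k • h) :=
    funext fun n => sum_range_succ_sub_sum _
  have newton := shift_eq_sum_fwdDiff_iter 1 (fun n : ℕ => ∑ k ∈ range n, f (y + k • h)) n 0
  simpa [sum_range_succ' _ n, hΔ, fwdDiff_iter_comp_nsmul] using newton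

end ForwardDifferences

section ExponentialGeneratingFunctions

variable {K : Type*} [Field K]

/-- The exponential generating function `∑ aₙ Xⁿ / n!` of a sequence `a`. -/
def egf (a : ℕ → K) : K⟦X⟧ :=
  PowerSeries.mk fun n => a n / n !

theorem coeff_egf (a : ℕ → K) (n : ℕ) : coeff n (egf a) = a n / n ! :=
  coeff_mk _ _

variable [CharZero K]

theorem egf_injective : Function.Injective (egf : (ℕ → K) → K⟦X⟧) := fun a b hab => by
  funext n
  have hn := congrArg (coeff n) hab
  rwa [coeff_egf, coeff_egf, div_left_inj' (by exact_mod_cast n.factorial_ne_zero)] at hn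

theorem derivative_egf (a : ℕ → K) : d⁄dX K (egf a) = egf fun n => a (n + 1) := by
  ext n
  have : (n : K) + 1 ≠ 0 := by exact_mod_cast n.succ_ne_zero
  rw [coeff_derivative, coeff_egf, coeff_egf, Nat.factorial_succ]
  push_cast
  field_simp

theorem egf_mul_egf (a b : ℕ → K) :
    egf a * egf b = egf fun n => ∑ i ∈ range (n + 1), n.choose i * a i * b (n - i) := by
  ext n
  rw [coeff_mul, coeff_egf, Nat.sum_antidiagonal_eq_sum_range_succ_mk, sum_div]
  refine sum_congr rfl fun i hi => ?_
  have h_fact (k : ℕ) : (k ! : K) ≠ 0 := by exact_mod_cast k.factorial_ne_zero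
  rw [coeff_egf, coeff_egf, Nat.cast_choose K (mem_range_succ_iff.1 hi)]
  field_simp [h_fact]

end ExponentialGeneratingFunctions

section TaylorSeries

variable {𝕜 : Type*} [NontriviallyNormedField 𝕜] {f g : 𝕜 → 𝕜} {x : 𝕜}

/-- The Taylor series `∑ f⁽ⁿ⁾(x) Xⁿ / n!` of `f` at `x`, as a formal power series. -/
noncomputable def taylorSeries (f : 𝕜 → 𝕜) (x : 𝕜) : 𝕜⟦X⟧ :=
  egf fun n => iteratedDeriv n f x

theorem constantCoeff_taylorSeries (f : 𝕜 → 𝕜) (x : 𝕜) :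
    constantCoeff (taylorSeries f x) = f x := by
  simp [taylorSeries, ← coeff_zero_eq_constantCoeff_apply, coeff_egf]

theorem taylorSeries_congr (hfg : f =ᶠ[𝓝 x] g) : taylorSeries f x = taylorSeries g x :=
  congrArg egf (funext fun n => hfg.iteratedDeriv_eq n)

theorem taylorSeries_neg (f : 𝕜 → 𝕜) (x : 𝕜) : taylorSeries (-f) x = -taylorSeries f x := by
  ext n
  simp [taylorSeries, coeff_egf, iteratedDeriv_neg, neg_div]

theorem taylorSeries_const (c x : 𝕜) : taylorSeries (fun _ => c) x = C c := by
  ext n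
  cases n <;> simp [taylorSeries, coeff_egf, coeff_C, iteratedDeriv_const]

variable [CharZero 𝕜]

theorem derivative_taylorSeries (f : 𝕜 → 𝕜) (x : 𝕜) :
    d⁄dX 𝕜 (taylorSeries f x) = taylorSeries (deriv f) x := by
  simp only [taylorSeries, derivative_egf, iteratedDeriv_succ']

theorem taylorSeries_mul (hf : ContDiffAt 𝕜 ∞ f x) (hg : ContDiffAt 𝕜 ∞ g x) :
    taylorSeries (f * g) x = taylorSeries f x * taylorSeries g x := by
  rw [taylorSeries, taylorSeries, taylorSeries, egf_mul_egf]
  congr 1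
  funext n
  exact iteratedDeriv_mul (hf.of_le (mod_cast le_top)) (hg.of_le (mod_cast le_top))

end TaylorSeries

section SineAndCosine

theorem derivative_taylorSeries_sin :
    d⁄dX ℝ (taylorSeries Real.sin 0) = taylorSeries Real.cos 0 := by
  rw [derivative_taylorSeries, Real.deriv_sin]

theorem derivative_taylorSeries_cos :
    d⁄dX ℝ (taylorSeries Real.cos 0) = -taylorSeries Real.sin 0 := by
  rw [derivative_taylorSeries, Real.deriv_cos', ← taylorSeries_neg, Pi.neg_def]

theorem taylorSeries_cos_ne_zero : taylorSeries Real.cos 0 ≠ 0 := fun h => by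
  simpa [constantCoeff_taylorSeries] using congrArg constantCoeff h

theorem taylorSeries_sin_sq_add_cos_sq :
    taylorSeries Real.sin 0 ^ 2 + taylorSeries Real.cos 0 ^ 2 = 1 := by
  apply PowerSeries.derivative.ext
  · simp only [map_add, derivative_pow, derivative_taylorSeries_sin, derivative_taylorSeries_cos,
      Derivation.map_one_eq_zero]
    ring
  · simp [constantCoeff_taylorSeries]

theorem taylorSeries_tan_mul_cos :
    taylorSeries Real.tan 0 * taylorSeries Real.cos 0 = taylorSeries Real.sin 0 := by
  have h_cos : ∀ᶠ u : ℝ in 𝓝 0, Real.cos u ≠ 0 :=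
    Real.continuous_cos.continuousAt.eventually_ne (by simp)
  rw [← taylorSeries_mul (Real.contDiffAt_tan.2 (by simp)) Real.contDiff_cos.contDiffAt]
  exact taylorSeries_congr (h_cos.mono fun u hu => Real.tan_mul_cos hu)

theorem taylorSeries_sec_mul_cos :
    taylorSeries (fun u => 1 / Real.cos u) 0 * taylorSeries Real.cos 0 = 1 := by
  have h_cos : ∀ᶠ u : ℝ in 𝓝 0, Real.cos u ≠ 0 :=
    Real.continuous_cos.continuousAt.eventually_ne (by simp)
  have h_sec : ContDiffAt ℝ ∞ (fun u => 1 / Real.cos u) 0 :=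
    contDiffAt_const.div Real.contDiff_cos.contDiffAt (by simp)
  rw [← taylorSeries_mul h_sec Real.contDiff_cos.contDiffAt, ← map_one C, ← taylorSeries_const 1 0]
  exact taylorSeries_congr (h_cos.mono fun u hu => one_div_mul_cancel hu)

/-- The derivatives `pₙ` of `sin u cos u` at `0`. Their recurrence `pₙ₊₂ = -4 pₙ` is the one that
the system imposes on the differences at `k = 1`. -/
noncomputable def sinMulCosCoeff (n : ℕ) : ℝ :=
  iteratedDeriv n (Real.sin * Real.cos) 0

theorem deriv_sin_mul_cos : deriv (Real.sin * Real.cos) = Real.cos ^ 2 - Real.sin ^ 2 := by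
  funext u
  rw [((Real.hasDerivAt_sin u).mul (Real.hasDerivAt_cos u)).deriv, Pi.sub_apply, Pi.pow_apply,
    Pi.pow_apply]
  ring

theorem deriv_cos_sq_sub_sin_sq :
    deriv (Real.cos ^ 2 - Real.sin ^ 2) = fun u => -4 * (Real.sin * Real.cos) u := by
  funext u
  rw [(((Real.hasDerivAt_cos u).pow 2).sub ((Real.hasDerivAt_sin u).pow 2)).deriv, Pi.mul_apply]
  ring

theorem sinMulCosCoeff_zero : sinMulCosCoeff 0 = 0 := by
  simp [sinMulCosCoeff]

theorem sinMulCosCoeff_one : sinMulCosCoeff 1 = 1 := by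
  simp [sinMulCosCoeff]

theorem sinMulCosCoeff_add_two (n : ℕ) : sinMulCosCoeff (n + 2) = -4 * sinMulCosCoeff n := by
  rw [sinMulCosCoeff, iteratedDeriv_succ', iteratedDeriv_succ', deriv_sin_mul_cos,
    deriv_cos_sq_sub_sin_sq, iteratedDeriv_const_mul_field, sinMulCosCoeff]

theorem egf_sinMulCosCoeff :
    egf sinMulCosCoeff = taylorSeries Real.sin 0 * taylorSeries Real.cos 0 :=
  taylorSeries_mul Real.contDiff_sin.contDiffAt Real.contDiff_cos.contDiffAt

/-- The derivatives of `(sin u)²` at `0`, which occur in Newton's formula for the row sums. -/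
noncomputable def sinSqCoeff (n : ℕ) : ℝ :=
  iteratedDeriv n (Real.sin * Real.sin) 0

theorem sinSqCoeff_zero : sinSqCoeff 0 = 0 := by
  simp [sinSqCoeff]

theorem sinSqCoeff_succ (n : ℕ) : sinSqCoeff (n + 1) = 2 * sinMulCosCoeff n := by
  have h_deriv : deriv (Real.sin * Real.sin) = fun u => 2 * (Real.sin * Real.cos) u := by
    funext u
    rw [((Real.hasDerivAt_sin u).mul (Real.hasDerivAt_sin u)).deriv, Pi.mul_apply]
    ring
  rw [sinSqCoeff, iteratedDeriv_succ', h_deriv, iteratedDeriv_const_mul_field, sinMulCosCoeff]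

theorem egf_sinSqCoeff : egf sinSqCoeff = taylorSeries Real.sin 0 * taylorSeries Real.sin 0 :=
  taylorSeries_mul Real.contDiff_sin.contDiffAt Real.contDiff_sin.contDiffAt

end SineAndCosine

section Triangles

variable {α β : ℚ} {f f' : ℕ → ℕ → ℚ}

/-- The initial values `f_n(1) = α ∑_k f_{n-1}(k)` and `f_n(2) = β ∑_k f_{n-1}(k)` for `n ≥ 2`, with
`f_1(1) = 1`: both [tan1] and [sec1] are of this form. -/
def HasInitialValues (α β : ℚ) (f : ℕ → ℕ → ℚ) : Prop :=
  f 1 1 = 1 ∧ ∀ n : ℕ, 2 ≤ n → f n 1 = α * rowSum f (n - 1) ∧ f n 2 = β * rowSum f (n - 1)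

theorem tan1_iff_hasInitialValues : Tan1 f ↔ HasInitialValues 0 2 f := by
  simp only [Tan1, HasInitialValues, zero_mul]

theorem sec1_iff_hasInitialValues : Sec1 f ↔ HasInitialValues 1 3 f := by
  simp only [Sec1, HasInitialValues, one_mul]

theorem HasInitialValues.apply_one (hi : HasInitialValues α β f) (m : ℕ) :
    f (m + 2) 1 = α * rowSum f (m + 1) :=
  (hi.2 (m + 2) (by lia)).1

theorem HasInitialValues.apply_two (hi : HasInitialValues α β f) (m : ℕ) :
    f (m + 2) 2 = β * rowSum f (m + 1) :=
  (hi.2 (m + 2) (by lia)).2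

theorem rowSum_succ (f : ℕ → ℕ → ℚ) (m : ℕ) :
    rowSum f (m + 1) = ∑ k ∈ range (2 * m + 1), f (m + 1) (1 + k) := by
  rw [rowSum, ← Finset.Ico_add_one_right_eq_Icc, sum_Ico_eq_sum_range]
  rfl

/-- The row that the system puts below the row `r` if its first two entries are `a` and `b`; entries
are indexed from `1`. -/
def nextRow (r : ℕ → ℚ) (a b : ℚ) : ℕ → ℚ
  | 0 => 0
  | 1 => a
  | 2 => b
  | k + 3 => 2 * nextRow r a b (k + 2) - nextRow r a b (k + 1) - 4 * r (k + 1)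

/-- The solution of the system with the initial values `HasInitialValues α β`. -/
def solution (α β : ℚ) : ℕ → ℕ → ℚ
  | 0 => 0
  | 1 => 1
  | m + 2 =>
    let s := ∑ k ∈ Icc 1 (2 * (m + 1) - 1), solution α β (m + 1) k
    nextRow (solution α β (m + 1)) (α * s) (β * s)

theorem solvesSystem_solution (α β : ℚ) : SolvesSystem (solution α β) := by
  intro n k hn hk _
  obtain ⟨m, rfl⟩ := Nat.exists_eq_add_of_le' hn
  obtain ⟨l, rfl⟩ := Nat.exists_eq_add_of_le' hk
  simp only [Function.iterate_succ, Function.iterate_zero, Function.comp_apply, id, fwdDiff,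
    solution, nextRow, Nat.add_one_sub_one]
  ring

theorem hasInitialValues_solution (α β : ℚ) : HasInitialValues α β (solution α β) := by
  refine ⟨by simp [solution], fun n hn => ?_⟩
  obtain ⟨m, rfl⟩ := Nat.exists_eq_add_of_le' hn
  simp only [solution, nextRow, rowSum, Nat.add_one_sub_one, and_self]

theorem SolvesSystem.fwdDiff_iter_add_two (hf : SolvesSystem f) {m j : ℕ} (hj : j ≤ 2 * m) :
    (fwdDiff 1)^[j + 2] (f (m + 2)) 1 = -4 * (fwdDiff 1)^[j] (f (m + 1)) 1 := by
  have h_row : ∀ i ≤ j, (fwdDiff 1)^[2] (f (m + 2)) (1 + i • 1) =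
      ((-4 : ℚ) • f (m + 1)) (1 + i • 1) := fun i hij => by
    change _ = -4 * f (m + 1) (1 + i • 1)
    rw [neg_mul, eq_neg_iff_add_eq_zero]
    exact hf (m + 2) (1 + i • 1) (by lia) (by lia) (by rw [smul_eq_mul]; lia)
  rw [Function.iterate_add_apply, fwdDiff_iter_congr h_row, fwdDiff_iter_const_smul,
    Pi.smul_apply, smul_eq_mul]

theorem HasInitialValues.row_succ_eq (hi : HasInitialValues α β f) (hi' : HasInitialValues α β f')
    (hf : SolvesSystem f) (hf' : SolvesSystem f') {m : ℕ}
    (hrow : ∀ k ≤ 2 * m, f (m + 1) (1 + k) = f' (m + 1) (1 + k)) {k : ℕ} (hk : k ≤ 2 * m + 2) :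
    f (m + 2) (1 + k) = f' (m + 2) (1 + k) := by
  have h_sum : rowSum f (m + 1) = rowSum f' (m + 1) := by
    rw [rowSum_succ, rowSum_succ]
    exact sum_congr rfl fun k hk => hrow k (mem_range_succ_iff.1 hk)
  have h_one : f (m + 2) 1 = f' (m + 2) 1 := by rw [hi.apply_one, hi'.apply_one, h_sum]
  have h_two : f (m + 2) 2 = f' (m + 2) 2 := by rw [hi.apply_two, hi'.apply_two, h_sum]
  have newton (f : ℕ → ℕ → ℚ) := shift_eq_sum_fwdDiff_iter 1 (f (m + 2)) k 1
  simp only [smul_eq_mul, mul_one] at newton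
  rw [newton f, newton f']
  refine sum_congr rfl fun j hj => congrArg _ ?_
  match j, mem_range_succ_iff.1 hj with
  | 0, _ => exact h_one
  | 1, _ => simp [fwdDiff, h_one, h_two]
  | j + 2, hjk =>
    rw [hf.fwdDiff_iter_add_two (by lia), hf'.fwdDiff_iter_add_two (by lia)]
    exact congrArg _ (fwdDiff_iter_congr fun i hij => hrow (i • 1) (by rw [smul_eq_mul]; lia))

theorem HasInitialValues.sameTriangle (hi : HasInitialValues α β f)
    (hi' : HasInitialValues α β f') (hf : SolvesSystem f) (hf' : SolvesSystem f') :
    SameTriangle f f' := by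
  have h_row (m : ℕ) : ∀ k ≤ 2 * m, f (m + 1) (1 + k) = f' (m + 1) (1 + k) := by
    induction m with
    | zero => simpa using hi.1.trans hi'.1.symm
    | succ m ih => exact fun k hk => hi.row_succ_eq hi' hf hf' ih hk
  intro n k hn hk hkn
  obtain ⟨m, rfl⟩ := Nat.exists_eq_add_of_le' hn
  obtain ⟨l, rfl⟩ := Nat.exists_eq_add_of_le hk
  exact h_row m l (by lia)

end Triangles

section RowSums

variable {α β : ℚ} {f : ℕ → ℕ → ℚ}

/-- The sequence `0, r₁, 0, r₂, 0, …`, where `rₙ` is the sum of the `n`-th row. -/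
def rowSumSeq (f : ℕ → ℕ → ℚ) (N : ℕ) : ℚ :=
  if Odd N then rowSum f ((N + 1) / 2) else 0

/-- The difference `Δʲ f_n(1)`, where `2n = j + l + 2`, extended by `0` to odd `j + l`. With this
indexing the system becomes a recurrence in `j` alone. -/
def leadingDiff (f : ℕ → ℕ → ℚ) (j l : ℕ) : ℚ :=
  if Even (j + l) then (fwdDiff 1)^[j] (f ((j + l) / 2 + 1)) 1 else 0

theorem rowSumSeq_two_mul (f : ℕ → ℕ → ℚ) (m : ℕ) : rowSumSeq f (2 * m) = 0 :=
  if_neg (by simp)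

theorem rowSumSeq_two_mul_add_one (f : ℕ → ℕ → ℚ) (m : ℕ) :
    rowSumSeq f (2 * m + 1) = rowSum f (m + 1) := by
  rw [rowSumSeq, if_pos (by simp), show (2 * m + 1 + 1) / 2 = m + 1 by lia]

theorem leadingDiff_of_add_eq_two_mul (f : ℕ → ℕ → ℚ) {j l m : ℕ} (h : j + l = 2 * m) :
    leadingDiff f j l = (fwdDiff 1)^[j] (f (m + 1)) 1 := by
  rw [leadingDiff, h, if_pos (even_two_mul m), Nat.mul_div_cancel_left m two_pos]

theorem leadingDiff_of_add_eq_two_mul_add_one (f : ℕ → ℕ → ℚ) {j l m : ℕ}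
    (h : j + l = 2 * m + 1) : leadingDiff f j l = 0 := by
  rw [leadingDiff, h, if_neg (by simp)]

theorem rowSumSeq_succ (f : ℕ → ℕ → ℚ) (N : ℕ) : rowSumSeq f (N + 1) =
    ∑ j ∈ range (N + 1), (N + 1).choose (j + 1) * leadingDiff f j (N - j) := by
  have h_index : ∀ j ∈ range (N + 1), j + (N - j) = N := fun j hj =>
    Nat.add_sub_cancel' (mem_range_succ_iff.1 hj)
  obtain ⟨m, rfl | rfl⟩ := N.even_or_odd'
  · have newton := sum_range_shift_eq_sum_fwdDiff_iter (f (m + 1)) 1 1 (2 * m + 1)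
    simp only [smul_eq_mul, mul_one, nsmul_eq_mul] at newton
    rw [rowSumSeq_two_mul_add_one, rowSum_succ, newton]
    exact sum_congr rfl fun j hj => by rw [leadingDiff_of_add_eq_two_mul f (h_index j hj)]
  · rw [add_assoc, ← mul_add_one, rowSumSeq_two_mul]
    refine (sum_eq_zero fun j hj => ?_).symm
    rw [leadingDiff_of_add_eq_two_mul_add_one f (h_index j hj), mul_zero]

theorem HasInitialValues.leadingDiff_zero_zero (hi : HasInitialValues α β f) :
    leadingDiff f 0 0 = 1 :=
  (leadingDiff_of_add_eq_two_mul f (m := 0) rfl).trans hi.1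

theorem HasInitialValues.leadingDiff_zero_succ (hi : HasInitialValues α β f) (l : ℕ) :
    leadingDiff f 0 (l + 1) = α * rowSumSeq f l := by
  obtain ⟨m, rfl | rfl⟩ := l.even_or_odd'
  · rw [leadingDiff_of_add_eq_two_mul_add_one f (zero_add _), rowSumSeq_two_mul, mul_zero]
  · rw [leadingDiff_of_add_eq_two_mul f (m := m + 1) (by lia), rowSumSeq_two_mul_add_one]
    exact hi.apply_one m

theorem HasInitialValues.leadingDiff_one (hi : HasInitialValues α β f) (l : ℕ) :
    leadingDiff f 1 l = (β - α) * rowSumSeq f l := by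
  obtain ⟨m, rfl | rfl⟩ := l.even_or_odd'
  · rw [leadingDiff_of_add_eq_two_mul_add_one f (add_comm _ _), rowSumSeq_two_mul, mul_zero]
  · rw [leadingDiff_of_add_eq_two_mul f (m := m + 1) (by lia), rowSumSeq_two_mul_add_one, sub_mul,
      ← hi.apply_one, ← hi.apply_two]
    rfl

theorem SolvesSystem.leadingDiff_add_two (hf : SolvesSystem f) (j l : ℕ) :
    leadingDiff f (j + 2) l = -4 * leadingDiff f j l := by
  obtain ⟨m, hm | hm⟩ := (j + l).even_or_odd'
  · rw [leadingDiff_of_add_eq_two_mul f hm,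
      leadingDiff_of_add_eq_two_mul f (m := m + 1) (by lia), hf.fwdDiff_iter_add_two (by lia)]
  · rw [leadingDiff_of_add_eq_two_mul_add_one f hm,
      leadingDiff_of_add_eq_two_mul_add_one f (m := m + 1) (by lia), mul_zero]

theorem SolvesSystem.leadingDiff_eq (hf : SolvesSystem f) (j l : ℕ) :
    (leadingDiff f j l : ℝ) =
      sinMulCosCoeff (j + 1) * leadingDiff f 0 l + sinMulCosCoeff j * leadingDiff f 1 l := by
  induction j using Nat.twoStepInduction with
  | zero => simp [sinMulCosCoeff_zero, sinMulCosCoeff_one]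
  | one => simp [sinMulCosCoeff_add_two, sinMulCosCoeff_zero, sinMulCosCoeff_one]
  | more j ih _ =>
    rw [hf.leadingDiff_add_two, add_right_comm, sinMulCosCoeff_add_two, sinMulCosCoeff_add_two]
    push_cast
    rw [ih]
    ring

theorem SolvesSystem.two_mul_rowSumSeq (hf : SolvesSystem f) (N : ℕ) :
    2 * (rowSumSeq f N : ℝ) =
      2 * ∑ i ∈ range (N + 1), N.choose i * sinMulCosCoeff i * leadingDiff f 0 (N - i) +
        ∑ i ∈ range (N + 1), N.choose i * sinSqCoeff i * leadingDiff f 1 (N - i) := by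
  cases N with
  | zero => simp [rowSumSeq, sinMulCosCoeff_zero, sinSqCoeff_zero]
  | succ N =>
    simp only [sum_range_succ' _ (N + 1), sinMulCosCoeff_zero, sinSqCoeff_zero, sinSqCoeff_succ,
      Nat.add_sub_add_right, mul_zero, zero_mul, add_zero, mul_sum, ← sum_add_distrib]
    rw [rowSumSeq_succ]
    push_cast
    rw [mul_sum]
    refine sum_congr rfl fun j _ => ?_
    rw [hf.leadingDiff_eq]
    ring

/-- The series `∑ rₙ X^(2n-1) / (2n-1)!`, where `rₙ` is the sum of the `n`-th row. -/
noncomputable def rowSumSeries (f : ℕ → ℕ → ℚ) : ℝ⟦X⟧ :=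
  egf fun N => rowSumSeq f N

/-- The generating function of the differences `Δʲ f_n(1)` for fixed `j`: it is
`∑ f_{n+1}(1) X^(2n) / (2n)!` for `j = 0` and `∑ (f_{n+1}(2) - f_{n+1}(1)) X^(2n-1) / (2n-1)!` for
`j = 1`. -/
noncomputable def leadingDiffSeries (f : ℕ → ℕ → ℚ) (j : ℕ) : ℝ⟦X⟧ :=
  egf fun l => leadingDiff f j l

theorem SolvesSystem.two_mul_rowSumSeries (hf : SolvesSystem f) :
    2 * rowSumSeries f =
      2 * (taylorSeries Real.sin 0 * taylorSeries Real.cos 0 * leadingDiffSeries f 0) +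
        taylorSeries Real.sin 0 * taylorSeries Real.sin 0 * leadingDiffSeries f 1 := by
  rw [← egf_sinMulCosCoeff, ← egf_sinSqCoeff, leadingDiffSeries, leadingDiffSeries, egf_mul_egf,
    egf_mul_egf, rowSumSeries]
  ext N
  simp only [two_mul, map_add, coeff_egf, ← add_div]
  rw [← two_mul, hf.two_mul_rowSumSeq, two_mul]

theorem HasInitialValues.constantCoeff_leadingDiffSeries (hi : HasInitialValues α β f) :
    constantCoeff (leadingDiffSeries f 0) = 1 := by
  rw [leadingDiffSeries, ← coeff_zero_eq_constantCoeff_apply, coeff_egf, hi.leadingDiff_zero_zero]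
  simp

theorem HasInitialValues.derivative_leadingDiffSeries (hi : HasInitialValues α β f) :
    d⁄dX ℝ (leadingDiffSeries f 0) = C (α : ℝ) * rowSumSeries f := by
  rw [leadingDiffSeries, derivative_egf, rowSumSeries]
  ext N
  simp only [coeff_C_mul, coeff_egf, hi.leadingDiff_zero_succ, Rat.cast_mul, mul_div_assoc]

theorem HasInitialValues.leadingDiffSeries_one (hi : HasInitialValues α β f) :
    leadingDiffSeries f 1 = C (β - α : ℝ) * rowSumSeries f := by
  ext N
  simp only [leadingDiffSeries, rowSumSeries, coeff_C_mul, coeff_egf, hi.leadingDiff_one,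
    Rat.cast_mul, Rat.cast_sub, mul_div_assoc]

theorem HasInitialValues.rowSumSeries_mul_cos (hi : HasInitialValues α β f)
    (hαβ : β - α = 2) (hf : SolvesSystem f) :
    rowSumSeries f * taylorSeries Real.cos 0 =
      leadingDiffSeries f 0 * taylorSeries Real.sin 0 := by
  have h_newton := hf.two_mul_rowSumSeries
  have h_two : (C (β - α : ℝ) : ℝ⟦X⟧) = 2 := by
    rw [← Rat.cast_sub, hαβ, Rat.cast_ofNat, map_ofNat]
  have := algebraRat.charZero ℝ⟦X⟧
  rw [hi.leadingDiffSeries_one, h_two] at h_newton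
  apply mul_right_cancel₀ (mul_ne_zero two_ne_zero taylorSeries_cos_ne_zero)
  linear_combination h_newton + 2 * rowSumSeries f * taylorSeries_sin_sq_add_cos_sq

theorem HasInitialValues.rowSumSeries_eq_tan (hi : HasInitialValues 0 2 f)
    (hf : SolvesSystem f) : rowSumSeries f = taylorSeries Real.tan 0 := by
  have h_one : leadingDiffSeries f 0 = 1 := by
    apply PowerSeries.derivative.ext
    · simp [hi.derivative_leadingDiffSeries]
    · simp [hi.constantCoeff_leadingDiffSeries]
  apply mul_right_cancel₀ taylorSeries_cos_ne_zero
  rw [hi.rowSumSeries_mul_cos (by norm_num) hf, h_one, one_mul,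
    taylorSeries_tan_mul_cos]

theorem HasInitialValues.leadingDiffSeries_eq_sec (hi : HasInitialValues 1 3 f)
    (hf : SolvesSystem f) :
    leadingDiffSeries f 0 = taylorSeries (fun u => 1 / Real.cos u) 0 := by
  apply mul_right_cancel₀ taylorSeries_cos_ne_zero
  rw [taylorSeries_sec_mul_cos]
  apply PowerSeries.derivative.ext
  · have h_ode := hi.rowSumSeries_mul_cos (by norm_num) hf
    simp only [Derivation.leibniz, derivative_taylorSeries_cos, smul_eq_mul, mul_neg,
      hi.derivative_leadingDiffSeries, Rat.cast_one, map_one, one_mul,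
      Derivation.map_one_eq_zero]
    linear_combination h_ode
  · simp [hi.constantCoeff_leadingDiffSeries, constantCoeff_taylorSeries]

theorem HasInitialValues.rowSum_eq_tangentNumber (hi : HasInitialValues 0 2 f)
    (hf : SolvesSystem f) (m : ℕ) : (rowSum f (m + 1) : ℝ) = tangentNumber (2 * m + 1) := by
  rw [← rowSumSeq_two_mul_add_one]
  exact congrFun (egf_injective (hi.rowSumSeries_eq_tan hf)) (2 * m + 1)

theorem HasInitialValues.rowSum_eq_secantNumber (hi : HasInitialValues 1 3 f)
    (hf : SolvesSystem f) (m : ℕ) : (rowSum f (m + 1) : ℝ) = secantNumber (2 * m + 2) := by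
  rw [← rowSumSeq_two_mul_add_one, ← one_mul (rowSumSeq f _), ← hi.leadingDiff_zero_succ]
  exact congrFun (egf_injective (hi.leadingDiffSeries_eq_sec hf)) (2 * m + 2)

end RowSums

theorem theorem1p1 :
    ((∃ g : ℕ → ℕ → ℚ, SolvesSystem g ∧ Tan1 g) ∧
      (∀ g g' : ℕ → ℕ → ℚ, SolvesSystem g → Tan1 g → SolvesSystem g' → Tan1 g' →
        SameTriangle g g') ∧
      (∀ g : ℕ → ℕ → ℚ, SolvesSystem g → Tan1 g →
        ∀ n : ℕ, 1 ≤ n → (rowSum g n : ℝ) = tangentNumber (2 * n - 1))) ∧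
    ((∃ h : ℕ → ℕ → ℚ, SolvesSystem h ∧ Sec1 h) ∧
      (∀ h h' : ℕ → ℕ → ℚ, SolvesSystem h → Sec1 h → SolvesSystem h' → Sec1 h' →
        SameTriangle h h') ∧
      (∀ h : ℕ → ℕ → ℚ, SolvesSystem h → Sec1 h →
        ∀ n : ℕ, 1 ≤ n → (rowSum h n : ℝ) = secantNumber (2 * n))) := by
  simp only [tan1_iff_hasInitialValues, sec1_iff_hasInitialValues]
  refine ⟨⟨⟨_, solvesSystem_solution 0 2, hasInitialValues_solution 0 2⟩,
      fun g g' hg hi hg' hi' => hi.sameTriangle hi' hg hg', fun g hg hi n hn => ?_⟩,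
    ⟨_, solvesSystem_solution 1 3, hasInitialValues_solution 1 3⟩,
      fun h h' hh hi hh' hi' => hi.sameTriangle hi' hh hh', fun h hh hi n hn => ?_⟩
  · obtain ⟨m, rfl⟩ := Nat.exists_eq_add_of_le' hn
    exact hi.rowSum_eq_tangentNumber hg m
  · obtain ⟨m, rfl⟩ := Nat.exists_eq_add_of_le' hn
    exact hi.rowSum_eq_secantNumber hh m
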